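/- Let $\Lambda$ be a (linearly) ordered abelian group, let $0\le\delta\in\Lambda$, and let $(X,d)$ be a non-empty geodesic $\delta$-hyperbolic $\Lambda$-metric space: $d:X\times X\to\Lambda$ satisfies the usual axioms of a metric, any two points are joined by an isometric copy of a closed segment of $\Lambda$, and the Gromov products $(x\cdot y)_v=\tfrac12\bigl(d(x,v)+d(y,v)-d(x,y)\bigr)\in\Lambda_{\mathbb Q}=\mathbb Q\otimes\Lambda$ satisfy $(x\cdot y)_v\ge\min\{(x\cdot z)_v,(z\cdot y)_v\}-\delta$ for all $x,y,z,v\in X$. For a convex subgroup $\Lambda_0\subseteq\Lambda$, the $\Lambda_0$-subspaces of $X$ are the sets $\{y\in X: d(x,y)\in\Lambda_0\}$, $x\in X$; let $\Lambda_\delta$ be the smallest convex subgroup containing $\delta$. A sequence $(\lambda_i)$ in $\Lambda$ (or a double sequence in $\Lambda_{\mathbb Q}$) tends to infinity if for each $\alpha\in\Lambda$ its terms are eventually $\ge\alpha$. The boundary $\partial X$ is the set of classes of sequences $(x_i)$ in $X$ with $(x_i\cdot x_j)_v\to\infty$ as $i,j\to\infty$, where $(x_i)\sim(y_i)$ iff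 $(x_i\cdot y_j)_v\to\infty$ as $i,j\to\infty$ (this does not depend on $v$); $x_i\to a$ means that $(x_i)$ belongs to the class $a$. An isometry is here a distance-preserving bijection $\gamma:X\to X$. It is - *minimal* if no $\Lambda_0$-subspace with $\Lambda_0$ a non-trivial proper convex subgroup of $\Lambda$ is $\gamma$-invariant; - *elliptic* if for some $x\in X$ and $K\in\mathbb N$ the orbit $\{\gamma^nx:n\in\mathbb Z\}$ has diameter at most $K\delta$; - *parabolic* if for some $x\in X$ the diameter of $\{\gamma^nx:n\in\mathbb Z\}$ is not bounded by any element of $\Lambda$ and there is $a\in\partial X$ such that $\gamma^{n_i}x\to a$ for every sequence of integers $(n_i)$ with $d(x,\gamma^{n_i}x)\to\infty$; - *hyperbolic* if for every $x\in X$ the diameter of $\{\gamma^nx:n\in\mathbb Z\}$ is not bounded by any element of $\Lambda$ and there are distinct $a,b\in\partial X$ such that $\gamma^{-n_i}x\to a$ and $\gamma^{n_i}x\to b$ for every sequence of natural numbers $(n_i)$ with $d(x,\gamma^{n_i}x)\to\infty$; - an *inversion* if $\gamma$ leaves no $\Lambda_\delta$-subspace of $X$ invariant but $\gamma^2$ does.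 Let $\gamma$ be a minimal isometry of $X$. 1. If $\Lambda=2\Lambda$, then $\gamma$ is elliptic, parabolic or hyperbolic. 2. If $\Lambda\ne2\Lambda$, and the Gromov products of $X$ lie in $\Lambda$ up to $\Lambda_\delta$ (that is, for all $x,y,v\in X$ there are $\lambda\in\Lambda$ and $k\in\mathbb N$ with $|(x\cdot y)_v-\lambda|\le k\delta$), then $\gamma$ is elliptic, parabolic, hyperbolic or an inversion. The condition in 2 holds automatically if $\Lambda_\delta=\Lambda$, and whenever all Gromov products $(x\cdot y)_v$ lie in $\Lambda$. -/

import Mathlib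

/-- A `Λ`-metric on `X`, where `Λ` is a (linearly) ordered abelian group. -/
structure LambdaMetric (Λ X : Type*) [AddCommGroup Λ] [LinearOrder Λ] where
  /-- the distance function -/
  d : X → X → Λ
  nonneg : ∀ x y, 0 ≤ d x y
  eq_zero_iff : ∀ x y, d x y = 0 ↔ x = y
  symm : ∀ x y, d x y = d y x
  triangle : ∀ x y z, d x y ≤ d x z + d y z

/-- A convex subgroup of an ordered abelian group. -/
def IsConvexSubgroup {Λ : Type*} [AddCommGroup Λ] [LinearOrder Λ] (H : AddSubgroup Λ) : Prop :=
  (H : Set Λ).OrdConnected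

/-- `Λ_δ`: the smallest convex subgroup of `Λ` containing `δ ≥ 0`. It consists of all elements
whose absolute value is at most a natural multiple of `δ`; it is trivial for `δ = 0`. -/
def convexSpan {Λ : Type*} [AddCommGroup Λ] [LinearOrder Λ] [IsOrderedAddMonoid Λ]
    (δ : Λ) : AddSubgroup Λ where
  carrier := {α | ∃ k : ℕ, |α| ≤ k • |δ|}
  zero_mem' := ⟨0, by simp⟩
  add_mem' := by
    rintro a b ⟨k, hk⟩ ⟨l, hl⟩
    exact ⟨k + l, (abs_add_le a b).trans (by rw [add_nsmul]; exact add_le_add hk hl)⟩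
  neg_mem' := by
    rintro a ⟨k, hk⟩
    exact ⟨k, by rwa [abs_neg]⟩

/-- A sequence of elements of `Λ` converges to infinity. -/
def SeqToInfinity {Λ : Type*} [LinearOrder Λ] (u : ℕ → Λ) : Prop :=
  ∀ α : Λ, ∃ N : ℕ, ∀ i, N ≤ i → α ≤ u i

namespace LambdaMetric

section Metric

variable {Λ X : Type*} [AddCommGroup Λ] [LinearOrder Λ] (D : LambdaMetric Λ X)

/-- `X` is geodesic: any two points are the endpoints of a segment, i.e. of the image of an
isometry defined on a closed segment `[a, b]` of `Λ`. -/
def IsGeodesic : Prop :=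
  ∀ x y : X, ∃ a b : Λ, a ≤ b ∧ ∃ f : Set.Icc a b → X,
    (∀ s t : Set.Icc a b, D.d (f s) (f t) = |(s : Λ) - (t : Λ)|) ∧
    (∃ s : Set.Icc a b, (s : Λ) = a ∧ f s = x) ∧ (∃ t : Set.Icc a b, (t : Λ) = b ∧ f t = y)

/-- The `Λ₀`-metric subspace of `X` through `x`. -/
def subspace (Λ₀ : AddSubgroup Λ) (x : X) : Set X := {y | D.d x y ∈ Λ₀}

/-- The bijection `γ` of `X` is an isometry. -/
def IsIsom (γ : Equiv.Perm X) : Prop := ∀ x y, D.d (γ x) (γ y) = D.d x y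

/-- `γ` leaves some `Λ₀`-subspace of `X` invariant (as a set). -/
def FixesSubspace (Λ₀ : AddSubgroup Λ) (γ : Equiv.Perm X) : Prop :=
  ∃ x : X, γ '' D.subspace Λ₀ x = D.subspace Λ₀ x

/-- `γ` is minimal: there is no `γ`-invariant `Λ₀`-subspace with `Λ₀` a non-trivial proper convex
subgroup of `Λ`. -/
def IsMinimal (γ : Equiv.Perm X) : Prop :=
  ∀ Λ₀ : AddSubgroup Λ, IsConvexSubgroup Λ₀ → Λ₀ ≠ ⊥ → Λ₀ ≠ ⊤ → ¬ D.FixesSubspace Λ₀ γ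

/-- The diameter of the orbit `{γⁿ x | n ∈ ℤ}` is at most `α`. -/
def OrbitDiamLE (γ : Equiv.Perm X) (x : X) (α : Λ) : Prop :=
  ∀ m n : ℤ, D.d ((γ ^ m) x) ((γ ^ n) x) ≤ α

/-- `γ` is elliptic: some orbit has diameter at most `K δ` for some natural number `K`. -/
def IsElliptic (δ : Λ) (γ : Equiv.Perm X) : Prop :=
  ∃ x : X, ∃ K : ℕ, D.OrbitDiamLE γ x (K • δ)

end Metric

section Hyperbolic

variable {Λ X : Type*} [AddCommGroup Λ] [LinearOrder Λ] [IsOrderedAddMonoid Λ]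
  (D : LambdaMetric Λ X)

/-- The Gromov product `(x · y)_v = (d(x,v) + d(y,v) - d(x,y)) / 2`, an element of the ordered
divisible hull `ℚ ⊗ Λ` of `Λ`. -/
noncomputable def gromovProduct (v x y : X) : DivisibleHull Λ :=
  DivisibleHull.mk (D.d x v + D.d y v - D.d x y) 2

/-- `X` is `δ`-hyperbolic (with respect to every base point). -/
def IsHyperbolic (δ : Λ) : Prop :=
  ∀ v x y z : X,
    min (D.gromovProduct v x z) (D.gromovProduct v z y) - (δ : DivisibleHull Λ)
      ≤ D.gromovProduct v x y

/-- `lim (x_i · y_j)_v = ∞` as `i, j → ∞`, for every base point `v` (equivalently, for one). -/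
def GromovToInfinity (s t : ℕ → X) : Prop :=
  ∀ (v : X) (α : Λ), ∃ N : ℕ, ∀ i j, N ≤ i → N ≤ j →
    (α : DivisibleHull Λ) ≤ D.gromovProduct v (s i) (t j)

/-- The sequence `s` of points converges to infinity. -/
def ConvergesToInfinity (s : ℕ → X) : Prop := D.GromovToInfinity s s

/-- The boundary at infinity `∂X`: the set of classes of sequences converging to infinity, two of
them being equivalent if they are close. A sequence converges to `a ∈ ∂X` if it belongs to `a`. -/
def boundary : Set (Set (ℕ → X)) :=
  {a | ∃ s, D.ConvergesToInfinity s ∧ a = {t | D.ConvergesToInfinity t ∧ D.GromovToInfinity s t}}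

/-- `γ` is parabolic with respect to `x`. -/
def IsParabolicAt (γ : Equiv.Perm X) (x : X) : Prop :=
  (¬ ∃ α : Λ, D.OrbitDiamLE γ x α) ∧
  ∃ a ∈ D.boundary, ∀ n : ℕ → ℤ,
    SeqToInfinity (fun i => D.d x ((γ ^ n i) x)) → (fun i => (γ ^ n i) x) ∈ a

/-- `γ` is parabolic. -/
def IsParabolic (γ : Equiv.Perm X) : Prop := ∃ x : X, D.IsParabolicAt γ x

/-- `γ` is hyperbolic with respect to `x`. -/
def IsHyperbolicIsomAt (γ : Equiv.Perm X) (x : X) : Prop :=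
  (¬ ∃ α : Λ, D.OrbitDiamLE γ x α) ∧
  ∃ a ∈ D.boundary, ∃ b ∈ D.boundary, a ≠ b ∧ ∀ n : ℕ → ℕ,
    SeqToInfinity (fun i => D.d x ((γ ^ (n i : ℤ)) x)) →
      (fun i => (γ ^ (-(n i : ℤ))) x) ∈ a ∧ (fun i => (γ ^ (n i : ℤ)) x) ∈ b

/-- `γ` is hyperbolic: it is so with respect to every point. -/
def IsHyperbolicIsom (γ : Equiv.Perm X) : Prop := ∀ x : X, D.IsHyperbolicIsomAt γ x

/-- `γ` is an inversion: it fixes no `Λ_δ`-subspace, but its square does. -/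
def IsInversion (δ : Λ) (γ : Equiv.Perm X) : Prop :=
  ¬ D.FixesSubspace (convexSpan δ) γ ∧ D.FixesSubspace (convexSpan δ) (γ ^ 2)

/-- Up to an error in `Λ_δ`, all Gromov products lie in `Λ`. For `δ = 0` this says that they lie
in `Λ`; in general it is a condition on the Gromov products of the space obtained by collapsing
the `Λ_δ`-subspaces. -/
def GromovProductsIntegral (δ : Λ) : Prop :=
  ∀ v x y : X, ∃ (l : Λ) (k : ℕ),
    |D.gromovProduct v x y - (l : DivisibleHull Λ)| ≤ k • (δ : DivisibleHull Λ)

end Hyperbolic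

end LambdaMetric

/-!
The convex span of a displacement `d(x, γ x)` contains the displacements of all powers of `γ`, so
the corresponding subspace of `x` is `γ`-invariant. By minimality every point is therefore either
fixed, in which case `γ` is elliptic, or displaced by an element whose multiples are cofinal in `Λ`
(`LambdaMetric.IsMinimal.hasCofinalMultiples`). Assume that there are no fixed points.

If `δ` has cofinal multiples, a bounded orbit has diameter at most a multiple of `δ`, and the
classical dichotomy applies to an unbounded one. When `d(x, γ²ⁿ x) ≤ d(x, γⁿ x) + 4δ` for all `n`,
the four-point inequality bounds the Gromov products of orbit points below by half the smaller
displacement, so the whole orbit accumulates at a single boundary point and `γ` is parabolic. When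
this fails for some `n`, the displacements of the powers of `γⁿ` grow linearly, its two half-orbits
converge to two different boundary points, and `γ` is hyperbolic
(`LambdaMetric.IsHyperbolic.isHyperbolicIsom`).

If `δ` does not have cofinal multiples, then `γ` acts up to negligible errors as on a tree. Compare
`s = d(x, γ² x) - d(x, γ x)` with `Λ`. If the multiples of `s` are cofinal, the linear growth
argument, available because `s` then exceeds all multiples of `δ`,
shows that `γ` is hyperbolic. Otherwise take the points `p`, `q` of a geodesic `[x, γ x]`
at distance `l` from its two ends, where `l` is about the Gromov product of `x` and `γ² x` at `γ x`.
Thinness gives `γ p ≈ q`. If `s ≥ 0` then `d(p, q) ≈ s`, so `p` has a displacement too small for a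
minimal isometry. If `s < 0` and `Λ = 2Λ`, the midpoint of `[x, γ x]` is almost fixed, with the same
contradiction; if only the Gromov products are available, then also `γ q ≈ p`, so `γ²` almost fixes
`p` and `γ` is an inversion (`LambdaMetric.IsHyperbolic.exists_flip`).
-/

/-! ### Cofinal multiples and convex spans -/

/-- The multiples of `s` exceed every element of `Λ`; for `0 ≤ s` this says that the smallest
convex subgroup containing `s` is `Λ` itself. -/
def HasCofinalMultiples {Λ : Type*} [AddCommGroup Λ] [LinearOrder Λ] (s : Λ) : Prop :=
  ∀ α : Λ, ∃ k : ℕ, α ≤ k • s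

section Ordered

variable {Λ : Type*} [AddCommGroup Λ] [LinearOrder Λ] [IsOrderedAddMonoid Λ]

theorem isConvexSubgroup_convexSpan (s : Λ) : IsConvexSubgroup (convexSpan s) := by
  refine ⟨?_⟩
  rintro a ⟨k, hk⟩ b ⟨l, hl⟩ c ⟨hac, hcb⟩
  refine ⟨k + l, ?_⟩
  rw [add_nsmul]
  generalize k • |s| = u at *
  generalize l • |s| = v at *
  grind

theorem mem_convexSpan_of_le {s a : Λ} (hs : 0 ≤ s) (ha : 0 ≤ a) {k : ℕ} (h : a ≤ k • s) :
    a ∈ convexSpan s :=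
  ⟨k, by rwa [abs_of_nonneg ha, abs_of_nonneg hs]⟩

theorem hasCofinalMultiples_of_convexSpan_eq_top {s : Λ} (hs : 0 ≤ s) (h : convexSpan s = ⊤) :
    HasCofinalMultiples s := by
  intro α
  obtain ⟨k, hk⟩ : α ∈ convexSpan s := h ▸ AddSubgroup.mem_top α
  exact ⟨k, (le_abs_self α).trans (by rwa [abs_of_nonneg hs] at hk)⟩

theorem convexSpan_eq_bot_iff {s : Λ} : convexSpan s = ⊥ ↔ s = 0 := by
  constructor
  · intro h
    have : s ∈ convexSpan s := ⟨1, by simp⟩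
    simpa [h] using this
  · rintro rfl
    refine (AddSubgroup.eq_bot_iff_forall _).2 ?_
    rintro a ⟨k, hk⟩
    simpa using hk

theorem HasCofinalMultiples.of_le_nsmul {s t : Λ} (hs : HasCofinalMultiples s) {k : ℕ}
    (h : s ≤ k • t) : HasCofinalMultiples t := by
  intro α
  obtain ⟨l, hl⟩ := hs α
  exact ⟨l * k, hl.trans (by rw [mul_nsmul']; exact nsmul_le_nsmul_right h l)⟩

/-- A sum has cofinal multiples only if the larger summand has. -/
theorem HasCofinalMultiples.left_or_right {s t : Λ} (h : HasCofinalMultiples (s + t)) :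
    HasCofinalMultiples s ∨ HasCofinalMultiples t := by
  rcases le_total s t with hst | hst
  · exact Or.inr (h.of_le_nsmul (k := 2) (by grind))
  · exact Or.inl (h.of_le_nsmul (k := 2) (by grind))

theorem HasCofinalMultiples.of_nsmul {s : Λ} {k : ℕ} (h : HasCofinalMultiples (k • s)) :
    HasCofinalMultiples s :=
  h.of_le_nsmul le_rfl

end Ordered

namespace LambdaMetric

section Metric

variable {Λ X : Type*} [AddCommGroup Λ] [LinearOrder Λ] {D : LambdaMetric Λ X}

/-! ### Isometries and their orbits -/

theorem dist_self (D : LambdaMetric Λ X) (x : X) : D.d x x = 0 := (D.eq_zero_iff x x).2 rfl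

theorem IsIsom.inv {γ : Equiv.Perm X} (hγ : D.IsIsom γ) : D.IsIsom γ⁻¹ := by
  intro x y
  rw [← hγ (γ⁻¹ x) (γ⁻¹ y)]
  simp

theorem IsIsom.pow {γ : Equiv.Perm X} (hγ : D.IsIsom γ) (n : ℕ) : D.IsIsom (γ ^ n) := by
  induction n with
  | zero => intro x y; simp
  | succ n ih => intro x y; rw [pow_succ, Equiv.Perm.mul_apply, Equiv.Perm.mul_apply, ih, hγ]

theorem IsIsom.zpow {γ : Equiv.Perm X} (hγ : D.IsIsom γ) (n : ℤ) : D.IsIsom (γ ^ n) := by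
  cases n with
  | ofNat n => simpa using hγ.pow n
  | negSucc n => rw [zpow_negSucc]; exact (hγ.pow _).inv

theorem IsIsom.dist_zpow {γ : Equiv.Perm X} (hγ : D.IsIsom γ) (x : X) (m n : ℤ) :
    D.d ((γ ^ m) x) ((γ ^ n) x) = D.d x ((γ ^ (n - m)) x) := by
  conv_lhs => rw [show n = m + (n - m) by ring, zpow_add, Equiv.Perm.mul_apply]
  exact hγ.zpow m _ _

theorem IsIsom.dist_zpow_neg {γ : Equiv.Perm X} (hγ : D.IsIsom γ) (x : X) (n : ℤ) :
    D.d x ((γ ^ (-n)) x) = D.d x ((γ ^ n) x) := by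
  rw [D.symm x ((γ ^ n) x)]
  simpa using (hγ.dist_zpow x n 0).symm

theorem IsIsom.dist_pow {γ : Equiv.Perm X} (hγ : D.IsIsom γ) (x : X) {m n : ℕ} (h : m ≤ n) :
    D.d ((γ ^ m) x) ((γ ^ n) x) = D.d x ((γ ^ (n - m)) x) := by
  have := hγ.dist_zpow x m n
  rwa [← Nat.cast_sub h, zpow_natCast, zpow_natCast, zpow_natCast] at this

theorem IsIsom.dist_pow_inv {γ : Equiv.Perm X} (hγ : D.IsIsom γ) (x : X) (n : ℕ) :
    D.d x ((γ⁻¹ ^ n) x) = D.d x ((γ ^ n) x) := by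
  have := hγ.dist_zpow_neg x n
  rwa [zpow_neg, ← inv_zpow, zpow_natCast, zpow_natCast] at this

theorem IsIsom.dist_pow_le [IsOrderedAddMonoid Λ] {γ : Equiv.Perm X} (hγ : D.IsIsom γ) (x : X)
    (n : ℕ) : D.d x ((γ ^ n) x) ≤ n • D.d x (γ x) := by
  induction n with
  | zero => simp [D.dist_self]
  | succ n ih =>
    have h1 := D.triangle x ((γ ^ (n + 1)) x) (γ x)
    have h2 : D.d ((γ ^ (n + 1)) x) (γ x) = D.d x ((γ ^ n) x) := by
      rw [pow_succ', Equiv.Perm.mul_apply, hγ, D.symm]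
    rw [succ_nsmul']
    rw [h2] at h1
    exact h1.trans (by gcongr)

/-- A point moved within its own `H`-subspace has a `γ`-invariant `H`-subspace. -/
theorem IsIsom.fixesSubspace [IsOrderedAddMonoid Λ] {γ : Equiv.Perm X} (hγ : D.IsIsom γ)
    {H : AddSubgroup Λ} (hH : IsConvexSubgroup H) {x : X} (hx : D.d x (γ x) ∈ H) :
    D.FixesSubspace H γ := by
  have key : ∀ y z w : X, D.d y z ∈ H → D.d w z ∈ H → D.d y w ∈ H := fun y z w h1 h2 =>
    hH.out H.zero_mem (H.add_mem h1 h2) ⟨D.nonneg _ _, D.triangle _ _ _⟩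
  refine ⟨x, Set.Subset.antisymm ?_ ?_⟩
  · rintro _ ⟨y, hy, rfl⟩
    refine key x (γ x) (γ y) hx ?_
    rw [hγ, D.symm]
    exact hy
  · intro y hy
    refine ⟨γ⁻¹ y, ?_, by simp⟩
    have h : D.d y (γ x) ∈ H := key y x (γ x) (by rw [D.symm]; exact hy) (by rw [D.symm]; exact hx)
    change D.d x (γ⁻¹ y) ∈ H
    rw [← hγ x (γ⁻¹ y), D.symm]
    simpa using h

theorem IsElliptic.of_fixed {δ : Λ} {γ : Equiv.Perm X} (hγ : D.IsIsom γ) {x : X}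
    (hx : γ x = x) : D.IsElliptic δ γ := by
  refine ⟨x, 0, fun m n => ?_⟩
  have : (γ ^ (n - m)) x = x := by
    exact Equiv.Perm.zpow_apply_eq_self_of_apply_eq_self hx _
  rw [hγ.dist_zpow, this, D.dist_self, zero_nsmul]

end Metric

section Hyperbolic

variable {Λ X : Type*} [AddCommGroup Λ] [LinearOrder Λ] [IsOrderedAddMonoid Λ]
  {D : LambdaMetric Λ X} {δ : Λ} {γ : Equiv.Perm X}

/-! ### The four-point inequality and convergence to the boundary -/

theorem coe_le_gromovProduct_iff {v x y : X} {α : Λ} :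
    (α : DivisibleHull Λ) ≤ D.gromovProduct v x y ↔ 2 • α ≤ D.d x v + D.d y v - D.d x y := by
  rw [gromovProduct, DivisibleHull.mk_le_mk]
  simp

/-- Hyperbolicity in terms of distances only, which avoids the divisible hull. -/
theorem IsHyperbolic.four_point (h : D.IsHyperbolic δ) (v x y z : X) :
    D.d x y + D.d z v ≤ max (D.d x z + D.d y v) (D.d z y + D.d x v) + 2 • δ := by
  have := h v x y z
  rw [sub_le_iff_le_add, min_le_iff, gromovProduct, gromovProduct, gromovProduct,
    DivisibleHull.mk_add_mk, DivisibleHull.mk_le_mk, DivisibleHull.mk_le_mk] at this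
  simp at this
  grind

theorem GromovProductsIntegral.exists_abs_le (h : D.GromovProductsIntegral δ) (v x y : X) :
    ∃ (l : Λ) (k : ℕ), |D.d x v + D.d y v - D.d x y - 2 • l| ≤ 2 • (k • δ) := by
  obtain ⟨l, k, hk⟩ := h v x y
  refine ⟨l, k, ?_⟩
  rw [abs_le] at hk ⊢
  rw [neg_le_iff_add_nonneg, sub_le_iff_le_add, gromovProduct, sub_add, sub_nonneg,
    DivisibleHull.nsmul_mk, sub_le_iff_le_add', DivisibleHull.mk_add_mk, DivisibleHull.mk_le_mk,
    DivisibleHull.mk_add_mk, DivisibleHull.mk_le_mk] at hk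
  simp at hk
  generalize k • δ = u at *
  grind

/-- Convergence of Gromov products may be checked at a single base point. -/
theorem gromovToInfinity_of_basepoint (x : X) {s t : ℕ → X}
    (h : ∀ α : Λ, ∃ N : ℕ, ∀ i j, N ≤ i → N ≤ j →
      2 • α ≤ D.d x (s i) + D.d x (t j) - D.d (s i) (t j)) : D.GromovToInfinity s t := by
  intro v α
  obtain ⟨N, hN⟩ := h (α + D.d x v)
  refine ⟨N, fun i j hi hj => ?_⟩
  have h0 := hN i j hi hj
  have h1 := D.triangle x (s i) v
  have h2 := D.triangle x (t j) v
  have h3 := D.symm (s i) v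
  have h4 := D.symm (t j) v
  rw [coe_le_gromovProduct_iff]
  grind

/-! ### Isometries without large translation -/

/-- Two geodesics issuing from `v` stay close up to the Gromov product of their endpoints. -/
theorem IsHyperbolic.dist_le_of_le_gromov (h : D.IsHyperbolic δ) (hδ : 0 ≤ δ)
    {v x y p q : X} {l u : Λ}
    (hu : 0 ≤ u) (hl : 2 • l ≤ D.d x v + D.d y v - D.d x y + 2 • u)
    (hvp : D.d v p = l) (hxp : D.d x p = D.d v x - l)
    (hvq : D.d v q = l) (hyq : D.d y q = D.d v y - l) : D.d p q ≤ 4 • δ + 2 • u := by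
  have h1 := h.four_point v p q x
  have h2 := h.four_point v x q y
  have s1 := D.symm p v
  have s2 := D.symm q v
  have s3 := D.symm x v
  have s4 := D.symm y v
  have s5 := D.symm x p
  have s6 := D.symm y q
  grind

/-- Minimality says that a displacement is either zero or as large as `Λ` permits. -/
theorem IsMinimal.hasCofinalMultiples (hmin : D.IsMinimal γ) (hγ : D.IsIsom γ) {x : X}
    (hx : γ x ≠ x) : HasCofinalMultiples (D.d x (γ x)) := by
  have hfix : D.FixesSubspace (convexSpan (D.d x (γ x))) γ :=
    hγ.fixesSubspace (isConvexSubgroup_convexSpan _) (x := x) ⟨1, by simp⟩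
  refine hasCofinalMultiples_of_convexSpan_eq_top (D.nonneg _ _) ?_
  by_contra htop
  refine hmin _ (isConvexSubgroup_convexSpan _) ?_ htop hfix
  rw [Ne, convexSpan_eq_bot_iff, D.eq_zero_iff]
  exact fun h => hx h.symm

/-- A `Λ_δ`-subspace can only be invariant if it is everything or a single point. -/
theorem IsMinimal.not_fixesSubspace (hmin : D.IsMinimal γ) (hδ : 0 ≤ δ)
    (hcof : ¬ HasCofinalMultiples δ) (hfree : ∀ x, γ x ≠ x) :
    ¬ D.FixesSubspace (convexSpan δ) γ := by
  intro hfix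
  by_cases h0 : convexSpan δ = ⊥
  · obtain ⟨x, hx⟩ := hfix
    have : γ x ∈ D.subspace (convexSpan δ) x := by
      rw [← hx]
      refine ⟨x, ?_, rfl⟩
      change D.d x x ∈ convexSpan δ
      rw [D.dist_self]
      exact zero_mem _
    change D.d x (γ x) ∈ convexSpan δ at this
    rw [h0, AddSubgroup.mem_bot, D.eq_zero_iff] at this
    exact hfree x this.symm
  · exact hmin _ (isConvexSubgroup_convexSpan δ) h0
      (fun h => hcof (hasCofinalMultiples_of_convexSpan_eq_top hδ h)) hfix

/-- Let `p` and `q` be the points of a geodesic `[x, γ x]` at distance `l` from `x` and from `γ x`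
respectively. If `l` does not exceed the Gromov product of `x` and `γ² x` at `γ x`, up to `u`,
then `γ p` is close to `q`; if moreover `p` comes after the midpoint, then `γ q` is close
to `p`, so that `γ` flips `p` and `q`. -/
theorem IsHyperbolic.exists_flip (h : D.IsHyperbolic δ) (hδ : 0 ≤ δ)
    (hgeo : D.IsGeodesic) (hγ : D.IsIsom γ) (x : X) {l u : Λ} (hu : 0 ≤ u) (h0 : 0 ≤ l) (hl : l ≤ D.d x (γ x))
    (hlu : 2 • l ≤ 2 • D.d x (γ x) - D.d x ((γ ^ 2) x) + 2 • u) :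
    ∃ p : X, D.d p (γ p) ≤ |D.d x (γ x) - 2 • l| + 4 • δ + 2 • u ∧
      (D.d x (γ x) ≤ 2 • l + 2 • u → D.d p ((γ ^ 2) p) ≤ 8 • δ + 8 • u) := by
  obtain ⟨a, b, hab, f, hf, ⟨s, hs, hsx⟩, ⟨r, hr, hrx⟩⟩ := hgeo x (γ x)
  have hd : D.d x (γ x) = b - a := by
    rw [← hrx, ← hsx, hf, abs_sub_comm, abs_of_nonneg] <;> grind
  have hsq : (γ ^ 2) x = γ (γ x) := rfl
  have mem1 : a + l ∈ Set.Icc a b := by constructor <;> grind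
  have mem2 : b - l ∈ Set.Icc a b := by constructor <;> grind
  obtain ⟨p, hp⟩ : ∃ p, p = f ⟨a + l, mem1⟩ := ⟨_, rfl⟩
  obtain ⟨q, hq⟩ : ∃ q, q = f ⟨b - l, mem2⟩ := ⟨_, rfl⟩
  have hxp : D.d x p = l := by rw [← hsx, hp, hf]; grind
  have hxq : D.d x q = D.d x (γ x) - l := by rw [hd, ← hsx, hq, hf]; grind
  have hyp : D.d (γ x) p = D.d x (γ x) - l := by rw [hd, ← hrx, hp, hf]; grind
  have hyq : D.d (γ x) q = l := by rw [← hrx, hq, hf]; grind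
  have hpq : D.d q p = |D.d x (γ x) - 2 • l| := by rw [hd, hp, hq, hf]; grind
  have e1 : D.d (γ (γ x)) (γ x) = D.d x (γ x) := by rw [hγ, D.symm]
  have e2 : D.d (γ x) (γ (γ x)) = D.d x (γ x) := by rw [hγ]
  have e3 : D.d (γ x) x = D.d x (γ x) := D.symm _ _
  rw [hsq] at hlu
  have close1 : D.d q (γ p) ≤ 4 • δ + 2 • u := by
    refine h.dist_le_of_le_gromov hδ (v := γ x) (x := x) (y := γ (γ x)) hu (l := l) ?_ hyq ?_ ?_ ?_
    · rw [e1]; grind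
    · rw [hxq, e3]
    · rw [hγ, hxp]
    · rw [hγ, hyp, e2]
  refine ⟨p, ?_, fun hmid => ?_⟩
  · have := D.triangle p (γ p) q
    have s1 := D.symm (γ p) q
    have s2 := D.symm p q
    grind
  · have close2 : D.d p (γ q) ≤ 4 • δ + 2 • (3 • u) := by
      refine h.dist_le_of_le_gromov hδ (v := γ x) (x := x) (y := γ (γ x)) (l := D.d x (γ x) - l)
        ?_ ?_ hyp ?_ ?_ ?_
      · grind
      · rw [e1]; grind
      · rw [hxp, e3]; grind
      · rw [hγ, hxq]
      · rw [hγ, hyq, e2]; grind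
    have h1 : (γ ^ 2) p = γ (γ p) := rfl
    have h2 := D.triangle p (γ (γ p)) (γ q)
    have h3 : D.d (γ (γ p)) (γ q) = D.d q (γ p) := by rw [hγ, D.symm]
    rw [h1]
    grind

/-! ### Isometries with large translation -/

/-- Orbit growth: once the second displacement exceeds the first by more than `2δ`, every further
step adds as much. -/
theorem IsHyperbolic.add_le_dist_pow_succ (h : D.IsHyperbolic δ) (hδ : 0 ≤ δ) (hγ : D.IsIsom γ)
    {x : X} {s : Λ} (hs : 0 < s)
    (hx : D.d x (γ x) + 2 • δ + s ≤ D.d x ((γ ^ 2) x)) (n : ℕ) :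
    D.d x ((γ ^ n) x) + s ≤ D.d x ((γ ^ (n + 1)) x) := by
  have h2 : D.d (γ x) ((γ ^ 2) x) = D.d x (γ x) := by
    have := hγ.dist_pow x (m := 1) (n := 2) (by norm_num)
    simpa using this
  induction n with
  | zero =>
    have := D.triangle x ((γ ^ 2) x) (γ x)
    have := D.symm ((γ ^ 2) x) (γ x)
    simp only [pow_zero, Equiv.Perm.one_apply, D.dist_self, zero_add, pow_one]
    grind
  | succ n ih =>
    have h4 := h.four_point (γ x) x ((γ ^ 2) x) ((γ ^ (n + 2)) x)
    have e1 := hγ.dist_pow x (m := 1) (n := n + 2) (by omega)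
    have e2 := hγ.dist_pow x (m := 2) (n := n + 2) (by omega)
    have s1 := D.symm ((γ ^ 2) x) (γ x)
    have s2 := D.symm ((γ ^ (n + 2)) x) (γ x)
    have s3 := D.symm ((γ ^ (n + 2)) x) ((γ ^ 2) x)
    have n1 : n + 2 - 1 = n + 1 := by omega
    have n2 : n + 2 - 2 = n := by omega
    rw [n1, pow_one] at e1
    rw [n2] at e2
    rw [show n + 1 + 1 = n + 2 by omega]
    grind

theorem IsHyperbolic.add_nsmul_le_dist_pow (h : D.IsHyperbolic δ) (hδ : 0 ≤ δ) (hγ : D.IsIsom γ)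
    {x : X} {s : Λ} (hs : 0 < s)
    (hx : D.d x (γ x) + 2 • δ + s ≤ D.d x ((γ ^ 2) x)) (m n : ℕ) :
    D.d x ((γ ^ m) x) + n • s ≤ D.d x ((γ ^ (m + n)) x) := by
  induction n with
  | zero => simp
  | succ n ih =>
    have := h.add_le_dist_pow_succ hδ hγ hs hx (m + n)
    rw [succ_nsmul, ← add_assoc m n 1]
    grind

/-- On a half-orbit the Gromov products grow linearly with the smaller exponent. -/
theorem IsHyperbolic.gromov_pow_ge (h : D.IsHyperbolic δ) (hδ : 0 ≤ δ) (hγ : D.IsIsom γ)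
    {x : X} {s : Λ} (hs : 0 < s)
    (hx : D.d x (γ x) + 2 • δ + s ≤ D.d x ((γ ^ 2) x)) {k m n : ℕ} (hm : k ≤ m) (hn : k ≤ n) :
    2 • (k • s) ≤ D.d x ((γ ^ m) x) + D.d x ((γ ^ n) x) - D.d ((γ ^ m) x) ((γ ^ n) x) := by
  wlog hmn : m ≤ n generalizing m n
  · have := this hn hm (by omega)
    rw [D.symm ((γ ^ m) x)]
    grind
  have h1 := h.add_nsmul_le_dist_pow hδ hγ hs hx 0 m
  have h2 := h.add_nsmul_le_dist_pow hδ hγ hs hx (n - m) m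
  have h3 : k • s ≤ m • s := nsmul_le_nsmul_left hs.le hm
  rw [Nat.sub_add_cancel hmn] at h2
  rw [hγ.dist_pow x hmn]
  simp only [pow_zero, Equiv.Perm.one_apply, D.dist_self, zero_add] at h1
  generalize k • s = a at *
  generalize m • s = b at *
  grind

/-- Two sequences at bounded distance from a half-orbit of large translation, with exponents
tending to infinity, are close to each other. -/
theorem IsHyperbolic.gromovToInfinity_of_fellow (h : D.IsHyperbolic δ) (hδ : 0 ≤ δ)
    (hγ : D.IsIsom γ) {x : X} {s : Λ} (hs : 0 < s) (hcof : HasCofinalMultiples s)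
    (hx : D.d x (γ x) + 2 • δ + s ≤ D.d x ((γ ^ 2) x)) {M : Λ} {u w : ℕ → X} {p q : ℕ → ℕ}
    (hp : Filter.Tendsto p .atTop .atTop) (hq : Filter.Tendsto q .atTop .atTop)
    (hu : ∀ i, D.d (u i) ((γ ^ p i) x) ≤ M) (hw : ∀ i, D.d (w i) ((γ ^ q i) x) ≤ M) :
    D.GromovToInfinity u w := by
  refine gromovToInfinity_of_basepoint x fun α => ?_
  obtain ⟨k, hk⟩ := hcof (α + 2 • M)
  obtain ⟨N, hN⟩ := Filter.eventually_atTop.1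
    ((hp.eventually_ge_atTop k).and (hq.eventually_ge_atTop k))
  refine ⟨N, fun i j hi hj => ?_⟩
  have h1 := h.gromov_pow_ge hδ hγ hs hx (hN i hi).1 (hN j hj).2
  have h2 := hu i
  have h3 := hw j
  generalize (γ ^ p i) x = y at *
  generalize (γ ^ q j) x = z at *
  generalize k • s = a at *
  have t1 := D.triangle x y (u i)
  have t2 := D.triangle x z (w j)
  have t3 := D.triangle (u i) (w j) y
  have t4 := D.triangle (w j) y z
  have s1 := D.symm y (u i)
  have s2 := D.symm z (w j)
  grind

/-- The two half-orbits of an isometry of large translation are not close to each other. -/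
theorem IsHyperbolic.not_gromovToInfinity_pow_inv (h : D.IsHyperbolic δ) (hδ : 0 ≤ δ)
    (hγ : D.IsIsom γ) {x : X} {s : Λ} (hs : δ < s)
    (hx : D.d x (γ x) + 2 • δ + s ≤ D.d x ((γ ^ 2) x)) :
    ¬ D.GromovToInfinity (fun n => (γ⁻¹ ^ n) x) (fun n => (γ ^ n) x) := by
  intro hlim
  obtain ⟨N, hN⟩ := hlim x (D.d x (γ x))
  have hN := hN (N + 1) (N + 1) (by omega) (by omega)
  rw [coe_le_gromovProduct_iff] at hN
  have hs0 : 0 < s := hδ.trans_lt hs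
  have g1 := h.add_le_dist_pow_succ hδ hγ hs0 hx N
  have e1 := hγ.dist_pow x (m := 1) (n := N + 1) (by omega)
  have e2 := hγ.inv.dist_pow x (m := 1) (n := N + 1) (by omega)
  have e3 := hγ.dist_pow_inv x (N + 1)
  have e4 := hγ.dist_pow_inv x N
  have e5 := hγ.dist_pow_inv x 1
  have e6 : D.d (γ⁻¹ x) (γ x) = D.d x ((γ ^ 2) x) := by
    rw [← hγ (γ⁻¹ x) (γ x), show γ (γ⁻¹ x) = x by simp]; rfl
  have h1 := h.four_point x (γ x) (γ⁻¹ x) ((γ ^ (N + 1)) x)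
  have h2 := h.four_point x ((γ ^ (N + 1)) x) (γ⁻¹ x) ((γ⁻¹ ^ (N + 1)) x)
  have t := D.triangle x ((γ ^ 2) x) (γ x)
  have e7 : D.d ((γ ^ 2) x) (γ x) = D.d x (γ x) := by
    change D.d (γ (γ x)) (γ x) = _; rw [hγ, D.symm]
  simp only [pow_one, Nat.add_sub_cancel] at e1 e2 e5
  have s1 := D.symm x (γ x)
  have s2 := D.symm x (γ⁻¹ x)
  have s3 := D.symm x ((γ ^ (N + 1)) x)
  have s4 := D.symm x ((γ⁻¹ ^ (N + 1)) x)
  have s5 := D.symm (γ x) (γ⁻¹ x)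
  have s6 := D.symm (γ x) ((γ ^ (N + 1)) x)
  have s7 := D.symm (γ⁻¹ x) ((γ⁻¹ ^ (N + 1)) x)
  have s8 := D.symm ((γ ^ (N + 1)) x) ((γ⁻¹ ^ (N + 1)) x)
  grind

/-! ### Hyperbolic isometries -/

/-- Every half-orbit of `γ` stays at bounded distance from a given half-orbit of `γ ^ N`. -/
theorem IsIsom.exists_dist_pow_div_le (hγ : D.IsIsom γ) {N : ℕ} (hN : 0 < N) (x y : X) :
    ∃ M : Λ, ∀ n : ℕ, D.d ((γ ^ n) y) (((γ ^ N) ^ (n / N)) x) ≤ M := by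
  refine ⟨D.d y x + N • D.d x (γ x), fun n => ?_⟩
  have h1 : (γ ^ n) y = (γ ^ (N * (n / N))) ((γ ^ (n % N)) y) := by
    rw [← Equiv.Perm.mul_apply, ← pow_add, Nat.div_add_mod]
  rw [h1, ← pow_mul, hγ.pow]
  have h2 := D.triangle ((γ ^ (n % N)) y) x ((γ ^ (n % N)) x)
  have h3 := hγ.dist_pow_le x (n % N)
  have h4 : (n % N) • D.d x (γ x) ≤ N • D.d x (γ x) :=
    nsmul_le_nsmul_left (D.nonneg _ _) (Nat.mod_lt _ hN).le
  rw [hγ.pow] at h2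
  exact h2.trans (by gcongr; exact h3.trans h4)

theorem IsIsom.tendsto_of_seqToInfinity (hγ : D.IsIsom γ) {s : Λ} (hs : 0 < s) {y : X} {n : ℕ → ℕ}
    (hn : SeqToInfinity fun i => D.d y ((γ ^ n i) y)) :
    Filter.Tendsto n .atTop .atTop := by
  refine Filter.tendsto_atTop.2 fun k => ?_
  obtain ⟨N, hN⟩ := hn (k • D.d y (γ y) + s)
  refine Filter.eventually_atTop.2 ⟨N, fun i hi => ?_⟩
  by_contra! hlt
  have h1 := hγ.dist_pow_le y (n i)
  have h2 : n i • D.d y (γ y) ≤ k • D.d y (γ y) :=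
    nsmul_le_nsmul_left (D.nonneg _ _) hlt.le
  exact absurd (((hN i hi).trans h1).trans h2) (by simpa using hs)

/-- A half-orbit of large translation of `γ ^ N` defines a boundary point to which all half-orbits
of `γ` converge. -/
theorem IsHyperbolic.exists_boundary_point (h : D.IsHyperbolic δ) (hδ : 0 ≤ δ) (hγ : D.IsIsom γ)
    {N : ℕ} (hN : 0 < N) {x : X} {s : Λ} (hs : 0 < s) (hcof : HasCofinalMultiples s)
    (hx : D.d x ((γ ^ N) x) + 2 • δ + s ≤ D.d x (((γ ^ N) ^ 2) x)) :
    ∃ a ∈ D.boundary, (∀ t ∈ a, D.GromovToInfinity (fun k => ((γ ^ N) ^ k) x) t) ∧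
      (fun k => ((γ ^ N) ^ k) x) ∈ a ∧
      ∀ (y : X) (n : ℕ → ℕ), SeqToInfinity (fun i => D.d y ((γ ^ n i) y)) →
        (fun i => (γ ^ n i) y) ∈ a := by
  have hconv : D.ConvergesToInfinity (fun k => ((γ ^ N) ^ k) x) :=
    h.gromovToInfinity_of_fellow hδ (hγ.pow N) hs hcof hx (M := 0) Filter.tendsto_id
      Filter.tendsto_id (fun i => (D.dist_self _).le) (fun i => (D.dist_self _).le)
  refine ⟨_, ⟨_, hconv, rfl⟩, fun t ht => ht.2, ⟨hconv, hconv⟩, fun y n hn => ?_⟩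
  obtain ⟨M, hM⟩ := hγ.exists_dist_pow_div_le hN x y
  have hM0 : 0 ≤ M := (D.nonneg _ _).trans (hM 0)
  have hdiv : Filter.Tendsto (fun i => n i / N) .atTop .atTop :=
    (Nat.tendsto_div_const_atTop hN.ne').comp (hγ.tendsto_of_seqToInfinity hs hn)
  exact ⟨h.gromovToInfinity_of_fellow hδ (hγ.pow N) hs hcof hx hdiv hdiv
      (fun i => hM (n i)) (fun i => hM (n i)),
    h.gromovToInfinity_of_fellow hδ (hγ.pow N) hs hcof hx Filter.tendsto_id hdiv
      (fun i => (D.dist_self _).le.trans hM0) (fun i => hM (n i))⟩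

theorem IsHyperbolic.isHyperbolicIsom (h : D.IsHyperbolic δ) (hδ : 0 ≤ δ) (hγ : D.IsIsom γ)
    {N : ℕ} (hN : 0 < N) {x : X} {s : Λ} (hs : δ < s) (hcof : HasCofinalMultiples s)
    (hx : D.d x ((γ ^ N) x) + 2 • δ + s ≤ D.d x (((γ ^ N) ^ 2) x)) :
    D.IsHyperbolicIsom γ := by
  have hs0 : 0 < s := hδ.trans_lt hs
  have hx' : D.d x ((γ⁻¹ ^ N) x) + 2 • δ + s ≤ D.d x (((γ⁻¹ ^ N) ^ 2) x) := by
    rw [← pow_mul] at hx ⊢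
    rwa [hγ.dist_pow_inv, hγ.dist_pow_inv]
  obtain ⟨a, ha, hag, -, hat⟩ := h.exists_boundary_point hδ hγ.inv hN hs0 hcof hx'
  obtain ⟨b, hb, -, hbm, hbt⟩ := h.exists_boundary_point hδ hγ hN hs0 hcof hx
  intro y
  refine ⟨?_, a, ha, b, hb, ?_, fun n hn => ?_⟩
  · rintro ⟨α, hα⟩
    obtain ⟨k, hk⟩ := hcof (α + 2 • D.d x y + s)
    have h1 := h.add_nsmul_le_dist_pow hδ (hγ.pow N) hs0 hx 0 k
    have h2 := hα 0 (N * k : ℕ)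
    rw [zpow_natCast, pow_mul] at h2
    simp only [pow_zero, zpow_zero, Equiv.Perm.one_apply, D.dist_self, zero_add] at h1 h2
    have t1 := D.triangle x (((γ ^ N) ^ k) x) y
    have t2 := D.triangle (((γ ^ N) ^ k) x) y (((γ ^ N) ^ k) y)
    rw [(hγ.pow N).pow] at t2
    generalize k • s = u at *
    grind
  · rintro rfl
    have h1 := hag _ hbm
    rw [inv_pow γ N] at h1
    exact h.not_gromovToInfinity_pow_inv hδ (hγ.pow N) hs hx h1
  · simp only [zpow_natCast] at hn
    refine ⟨?_, ?_⟩
    · have := hat y n (by simpa only [hγ.dist_pow_inv] using hn)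
      simpa only [zpow_neg, zpow_natCast, inv_pow] using this
    · simpa only [zpow_natCast] using hbt y n hn

/-! ### Parabolic isometries -/

/-- If doubling the exponent never adds much to the displacement, the Gromov product of two orbit
points is, up to `3δ`, at least half the smaller displacement. -/
theorem IsHyperbolic.min_dist_zpow_le_gromov (h : D.IsHyperbolic δ) (hδ : 0 ≤ δ) (hγ : D.IsIsom γ)
    {x : X} (hx : ∀ n : ℤ, D.d x ((γ ^ (2 * n)) x) ≤ D.d x ((γ ^ n) x) + 4 • δ) (m n : ℤ) :
    min (D.d x ((γ ^ m) x)) (D.d x ((γ ^ n) x)) ≤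
      D.d x ((γ ^ m) x) + D.d x ((γ ^ n) x) - D.d ((γ ^ m) x) ((γ ^ n) x) + 6 • δ := by
  have e1 : D.d ((γ ^ n) x) ((γ ^ (-n)) x) = D.d x ((γ ^ (2 * n)) x) := by
    rw [hγ.dist_zpow, ← hγ.dist_zpow_neg]; congr 3; ring
  have e2 : D.d ((γ ^ m) x) ((γ ^ (-n)) x) = D.d x ((γ ^ (m + n)) x) := by
    rw [hγ.dist_zpow, ← hγ.dist_zpow_neg]; congr 3; ring
  have e3 : D.d ((γ ^ (m + n)) x) ((γ ^ n) x) = D.d x ((γ ^ m) x) := by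
    rw [hγ.dist_zpow, ← hγ.dist_zpow_neg]; congr 3; ring
  have e4 : D.d ((γ ^ m) x) ((γ ^ (m + n)) x) = D.d x ((γ ^ n) x) := by
    rw [hγ.dist_zpow]; congr 3; ring
  have h1 := h.four_point x ((γ ^ m) x) ((γ ^ n) x) ((γ ^ (-n)) x)
  have h2 := h.four_point x ((γ ^ m) x) ((γ ^ n) x) ((γ ^ (m + n)) x)
  have h3 := hx n
  have e5 := hγ.dist_zpow_neg x n
  have s1 := D.symm x ((γ ^ m) x)
  have s2 := D.symm x ((γ ^ n) x)
  have s3 := D.symm x ((γ ^ (-n)) x)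
  have s4 := D.symm x ((γ ^ (m + n)) x)
  have s5 := D.symm ((γ ^ n) x) ((γ ^ (-n)) x)
  generalize D.d x ((γ ^ (2 * n)) x) = c at *
  grind

theorem IsHyperbolic.isParabolic (h : D.IsHyperbolic δ) (hδ : 0 ≤ δ) (hγ : D.IsIsom γ)
    (hcof : HasCofinalMultiples δ) {x : X} (hunb : ¬ ∃ α : Λ, D.OrbitDiamLE γ x α)
    (hx : ∀ n : ℤ, D.d x ((γ ^ (2 * n)) x) ≤ D.d x ((γ ^ n) x) + 4 • δ) : D.IsParabolic γ := by
  have conv : ∀ m n : ℕ → ℤ, SeqToInfinity (fun i => D.d x ((γ ^ m i) x)) →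
      SeqToInfinity (fun i => D.d x ((γ ^ n i) x)) →
      D.GromovToInfinity (fun i => (γ ^ m i) x) (fun i => (γ ^ n i) x) := by
    intro m n hm hn
    refine gromovToInfinity_of_basepoint x fun α => ?_
    obtain ⟨N, hN⟩ := hm (2 • α + 6 • δ)
    obtain ⟨N', hN'⟩ := hn (2 • α + 6 • δ)
    refine ⟨max N N', fun i j hi hj => ?_⟩
    have h1 := hN i (le_of_max_le_left hi)
    have h2 := hN' j (le_of_max_le_right hj)
    have h3 := h.min_dist_zpow_le_gromov hδ hγ hx (m i) (n j)
    have := le_min h1 h2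
    grind
  have hex : ∀ k : ℕ, ∃ n : ℤ, k • δ ≤ D.d x ((γ ^ n) x) := by
    intro k
    by_contra! hlt
    refine hunb ⟨k • δ, fun m n => ?_⟩
    rw [hγ.dist_zpow]
    exact (hlt _).le
  choose n hn using hex
  have hninf : SeqToInfinity (fun i => D.d x ((γ ^ n i) x)) := by
    intro α
    obtain ⟨k, hk⟩ := hcof α
    exact ⟨k, fun i hi => (hk.trans (nsmul_le_nsmul_left hδ hi)).trans (hn i)⟩
  exact ⟨x, hunb, _, ⟨_, conv n n hninf hninf, rfl⟩,
    fun m hm => ⟨conv m m hm hm, conv n m hninf hm⟩⟩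

/-! ### The classification -/

/-- The case where `Λ` is the convex span of `δ`, in which every bounded orbit has diameter at
most a multiple of `δ`. -/
theorem IsHyperbolic.classification_of_hasCofinalMultiples (h : D.IsHyperbolic δ) (hδ : 0 ≤ δ)
    (hγ : D.IsIsom γ) (hcof : HasCofinalMultiples δ) (x : X) :
    D.IsElliptic δ γ ∨ D.IsParabolic γ ∨ D.IsHyperbolicIsom γ := by
  by_cases hb : ∃ α : Λ, D.OrbitDiamLE γ x α
  · obtain ⟨α, hα⟩ := hb
    obtain ⟨K, hK⟩ := hcof α
    exact Or.inl ⟨x, K, fun m n => (hα m n).trans hK⟩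
  refine Or.inr ?_
  by_cases hx : ∀ n : ℤ, D.d x ((γ ^ (2 * n)) x) ≤ D.d x ((γ ^ n) x) + 4 • δ
  · exact Or.inl (h.isParabolic hδ hγ hcof hb hx)
  refine Or.inr ?_
  push Not at hx
  obtain ⟨n, hn⟩ := hx
  have key : D.d x ((γ ^ n.natAbs) x) + 4 • δ < D.d x (((γ ^ n.natAbs) ^ 2) x) := by
    rw [← pow_mul, mul_comm]
    rcases Int.natAbs_eq n with hn' | hn' <;> rw [hn'] at hn
    · exact_mod_cast hn
    · rw [mul_neg, hγ.dist_zpow_neg, hγ.dist_zpow_neg] at hn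
      exact_mod_cast hn
  have hN : n.natAbs ≠ 0 := by
    intro h0
    simp only [h0, pow_zero, one_pow, Equiv.Perm.one_apply, D.dist_self, zero_add] at key
    grind
  have hδ0 : δ ≠ 0 := by
    rintro rfl
    obtain ⟨k, hk⟩ := hcof (D.d x (((γ ^ n.natAbs) ^ 2) x))
    have := D.nonneg x ((γ ^ n.natAbs) x)
    simp at hk key
    grind
  refine h.isHyperbolicIsom hδ hγ (Nat.pos_of_ne_zero hN) (x := x) (s := 2 • δ) ?_
    (hcof.of_le_nsmul (k := 1) ?_) ?_ <;> grind

/-- If the convex span of `δ` is proper, a single point displaced by no more than the excess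
`d(x, γ² x) - d(x, γ x)`, up to a multiple of `δ`, forces `x` to have large translation: by
minimality that displacement has cofinal multiples, hence so has the excess. -/
theorem IsHyperbolic.isHyperbolicIsom_of_dist_le (h : D.IsHyperbolic δ) (hδ : 0 ≤ δ)
    (hγ : D.IsIsom γ) (hmin : D.IsMinimal γ) (hcof : ¬ HasCofinalMultiples δ)
    (hfree : ∀ x, γ x ≠ x) {x p : X} {k : ℕ}
    (hp : D.d p (γ p) ≤ max 0 (D.d x ((γ ^ 2) x) - D.d x (γ x)) + k • δ) :
    D.IsHyperbolicIsom γ := by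
  have hexc : HasCofinalMultiples (max 0 (D.d x ((γ ^ 2) x) - D.d x (γ x))) :=
    ((hmin.hasCofinalMultiples hγ (hfree p)).of_le_nsmul (k := 1)
      (by rwa [one_nsmul])).left_or_right.resolve_right fun h' => hcof h'.of_nsmul
  have hlarge : 8 • δ < max 0 (D.d x ((γ ^ 2) x) - D.d x (γ x)) := by
    by_contra! hle
    exact hcof (hexc.of_le_nsmul hle)
  have hmax : max 0 (D.d x ((γ ^ 2) x) - D.d x (γ x)) = D.d x ((γ ^ 2) x) - D.d x (γ x) := by
    grind
  rw [hmax] at hexc hlarge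
  refine h.isHyperbolicIsom hδ hγ one_pos (x := x)
    (s := D.d x ((γ ^ 2) x) - D.d x (γ x) - 2 • δ) ?_ (hexc.of_le_nsmul (k := 2) ?_) ?_
  · grind
  · grind
  · rw [pow_one]
    grind

theorem IsHyperbolic.isHyperbolicIsom_of_two_divisible (h : D.IsHyperbolic δ) (hδ : 0 ≤ δ)
    (hgeo : D.IsGeodesic) (hγ : D.IsIsom γ) (hmin : D.IsMinimal γ)
    (hcof : ¬ HasCofinalMultiples δ) (hfree : ∀ x, γ x ≠ x) [Nonempty X]
    (hdiv : ∀ l : Λ, ∃ m : Λ, l = 2 • m) : D.IsHyperbolicIsom γ := by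
  obtain ⟨x⟩ := ‹Nonempty X›
  -- `2 • l` is the smaller of `d(x, γ x)` and twice the Gromov product of `x`, `γ² x` at `γ x`
  obtain ⟨l, hl⟩ := hdiv (min (D.d x (γ x)) (2 • D.d x (γ x) - D.d x ((γ ^ 2) x)))
  have t := D.triangle x ((γ ^ 2) x) (γ x)
  have e : D.d ((γ ^ 2) x) (γ x) = D.d x (γ x) := by
    change D.d (γ (γ x)) (γ x) = _
    rw [hγ, D.symm]
  have ha := D.nonneg x (γ x)
  obtain ⟨p, hp, -⟩ := h.exists_flip hδ hgeo hγ x (l := l) le_rfl (by grind) (by grind) (by grind)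
  refine h.isHyperbolicIsom_of_dist_le hδ hγ hmin hcof hfree (x := x) (p := p) (k := 4) ?_
  grind

theorem IsHyperbolic.isHyperbolicIsom_or_isInversion (h : D.IsHyperbolic δ) (hδ : 0 ≤ δ)
    (hgeo : D.IsGeodesic) (hγ : D.IsIsom γ) (hmin : D.IsMinimal γ)
    (hcof : ¬ HasCofinalMultiples δ) (hfree : ∀ x, γ x ≠ x) [Nonempty X]
    (hint : D.GromovProductsIntegral δ) : D.IsHyperbolicIsom γ ∨ D.IsInversion δ γ := by
  obtain ⟨x⟩ := ‹Nonempty X›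
  obtain ⟨l₀, k, hl₀⟩ := hint.exists_abs_le (γ x) x ((γ ^ 2) x)
  have t := D.triangle x ((γ ^ 2) x) (γ x)
  have e : D.d ((γ ^ 2) x) (γ x) = D.d x (γ x) := by
    change D.d (γ (γ x)) (γ x) = _
    rw [hγ, D.symm]
  rw [e] at hl₀ t
  have ha := D.nonneg x (γ x)
  have ha2 := D.nonneg x ((γ ^ 2) x)
  have hu : 0 ≤ k • δ := nsmul_nonneg hδ k
  have hk4 : (4 * k + 4) • δ = 4 • (k • δ) + 4 • δ := by rw [add_nsmul, mul_nsmul']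
  have hk8 : (8 * k + 8) • δ = 8 • (k • δ) + 8 • δ := by rw [add_nsmul, mul_nsmul']
  generalize k • δ = u at *
  -- Clamping `l₀` to `[0, d(x, γ x)]`, where the Gromov product lies, preserves the estimate.
  obtain ⟨l, hl0, hla, hl⟩ : ∃ l : Λ, 0 ≤ l ∧ l ≤ D.d x (γ x) ∧
      |D.d x (γ x) + D.d x (γ x) - D.d x ((γ ^ 2) x) - 2 • l| ≤ 2 • u := by
    refine ⟨max 0 (min l₀ (D.d x (γ x))), by grind, by grind, ?_⟩
    grind
  obtain ⟨p, hp, hflip⟩ := h.exists_flip hδ hgeo hγ x (l := l) hu hl0 hla (by grind)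
  rcases le_or_gt (D.d x (γ x)) (D.d x ((γ ^ 2) x)) with hs | hs
  · refine Or.inl (h.isHyperbolicIsom_of_dist_le hδ hγ hmin hcof hfree (x := x) (p := p)
      (k := 4 * k + 4) ?_)
    rw [hk4]
    grind
  · refine Or.inr ⟨hmin.not_fixesSubspace hδ hcof hfree,
      (hγ.pow 2).fixesSubspace (isConvexSubgroup_convexSpan δ) (x := p)
        (mem_convexSpan_of_le hδ (D.nonneg _ _) (k := 8 * k + 8) ?_)⟩
    rw [hk8]
    have := hflip (by grind)
    grind

end Hyperbolic

end LambdaMetric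

/-- Classification of the minimal isometries of a geodesic `δ`-hyperbolic `Λ`-metric space. -/
theorem theorem2 {Λ X : Type*} [AddCommGroup Λ] [LinearOrder Λ] [IsOrderedAddMonoid Λ]
    [Nonempty X] (D : LambdaMetric Λ X) (δ : Λ) (hδ : 0 ≤ δ)
    (hgeo : D.IsGeodesic) (hhyp : D.IsHyperbolic δ)
    (γ : Equiv.Perm X) (hγ : D.IsIsom γ) (hmin : D.IsMinimal γ) :
    ((∀ l : Λ, ∃ m : Λ, l = 2 • m) →
      D.IsElliptic δ γ ∨ D.IsParabolic γ ∨ D.IsHyperbolicIsom γ) ∧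
    ((¬ ∀ l : Λ, ∃ m : Λ, l = 2 • m) → D.GromovProductsIntegral δ →
      D.IsElliptic δ γ ∨ D.IsParabolic γ ∨ D.IsHyperbolicIsom γ ∨ D.IsInversion δ γ) := by
  by_cases hfree : ∀ x, γ x ≠ x
  · by_cases hcof : HasCofinalMultiples δ
    · obtain ⟨x⟩ := ‹Nonempty X›
      have := hhyp.classification_of_hasCofinalMultiples hδ hγ hcof x
      exact ⟨fun _ => this, fun _ _ => by tauto⟩
    · exact ⟨fun hdiv => Or.inr (Or.inr (hhyp.isHyperbolicIsom_of_two_divisible hδ hgeo hγ hmin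
        hcof hfree hdiv)), fun _ hint => Or.inr (Or.inr
          (hhyp.isHyperbolicIsom_or_isInversion hδ hgeo hγ hmin hcof hfree hint))⟩
  · push Not at hfree
    obtain ⟨x, hx⟩ := hfree
    have := LambdaMetric.IsElliptic.of_fixed (δ := δ) hγ hx
    exact ⟨fun _ => Or.inl this, fun _ _ => Or.inl this⟩
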